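/- Let $n,m$ be non-negative integers, write $w=(x,v)\in\mathbb{R}^n\times\mathbb{R}^m=\mathbb{R}^{n+m}$, and let $1<p<\infty$, $1/p+1/p'=1$. Let $\alpha,\beta$ be real numbers with $0<\alpha+\beta<m$, $\alpha<m/p$ and $\beta<m/p'$. Then for every Schwartz function $g\in\mathcal{S}(\mathbb{R}^{n+m})$ $$\big\|\,|v|^{-\alpha}g\,\big\|_{L^p(\mathbb{R}^{n+m})}\le 2^{-(\alpha+\beta)}\left[\frac{\Gamma\big(\frac{m}{2p}-\frac{\alpha}{2}\big)\,\Gamma\big(\frac{m}{2p'}-\frac{\beta}{2}\big)}{\Gamma\big(\frac{m}{2p'}+\frac{\alpha}{2}\big)\,\Gamma\big(\frac{m}{2p}+\frac{\beta}{2}\big)}\right]\big\|\,|v|^{\beta}(-\Delta)^{(\alpha+\beta)/2}g\,\big\|_{L^p(\mathbb{R}^{n+m})},$$ where $\Delta$ is the Laplacian on $\mathbb{R}^{n+m}$ in all variables and, with $\hat g(\xi)=\int_{\mathbb{R}^{n+m}}e^{-2\pi i w\cdot\xi}g(w)\,dw$, $$(-\Delta)^{(\alpha+\beta)/2}g(w)=\int_{\mathbb{R}^{n+m}}e^{2\pi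 i w\cdot\xi}\,(2\pi|\xi|)^{\alpha+\beta}\,\hat g(\xi)\,d\xi .$$ -/

import Mathlib

open MeasureTheory
open scoped FourierTransform SchwartzMap ENNReal

noncomputable section

/-- The space `ℝⁿ × ℝᵐ = ℝⁿ⁺ᵐ` with its Euclidean structure and Lebesgue measure. A point is
`w = (x, v)`, where `x` has the coordinates `w (Sum.inl i)` and `v` has the coordinates
`w (Sum.inr j)`. -/
abbrev ProductSpace (n m : ℕ) : Type := EuclideanSpace ℝ (Fin n ⊕ Fin m)

/-- The component `v ∈ ℝᵐ` of a point `w = (x, v)` of `ℝⁿ × ℝᵐ`. -/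
def vPart {n m : ℕ} (w : ProductSpace n m) : EuclideanSpace ℝ (Fin m) :=
  WithLp.toLp 2 fun j => w (Sum.inr j)

/-- The power `(-Δ)^σ`, `σ ≥ 0`, of minus the Laplacian, on a Schwartz function `g`: the function
whose Fourier transform is `(2π|ξ|)^{2σ} ĝ(ξ)`, where `ĝ(ξ) = ∫ e^{-2πi⟨w,ξ⟩} g(w) dw`.
The inverse Fourier integral converges absolutely, so that this is an honest function. As the
multiplier is even, the sign in the exponent of the Fourier transform is immaterial. -/
def fracLaplacian {E : Type*} [NormedAddCommGroup E] [InnerProductSpace ℝ E]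
    [FiniteDimensional ℝ E] [MeasurableSpace E] [BorelSpace E]
    (σ : ℝ) (g : 𝓢(E, ℂ)) : E → ℂ :=
  𝓕⁻ fun ξ : E => (((2 * Real.pi * ‖ξ‖) ^ (2 * σ) : ℝ) : ℂ) * 𝓕 (g : E → ℂ) ξ

end

/-!
The proof rests on one representation of the Riesz kernel, as a mixture of heat kernels
`R_s = Γ(s/2)⁻¹ ∫₀^∞ t^{s/2-1} G_t dt` (`rieszKernel`), and on Schur's test.

*Reduction to an integral operator.* With `γ = α + β`, the heat semigroup has the multiplier
`e^{-t(2π‖ξ‖)²}`, and the Gamma integral in `t` of this multiplier is the inverse of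
`(2π‖ξ‖)^γ`. Fourier inversion then gives `|g| ≤ R_γ * |(-Δ)^{γ/2} g|` pointwise, as an inequality
in `[0, ∞]` (`enorm_le_lintegral_rieszKernel_mul_fracLaplacian`). It suffices to bound the operator
with the positive kernel `‖v‖^{-α} R_γ(w - w') ‖v'‖^{-β}` on `L^p`.

*Action on powers of `‖v‖`.* Heat kernels on `ℝⁿ⁺ᵐ` factor, and the factor in `x` integrates to
`1`, so the heat semigroup acts on functions of `v` alone as that of `ℝᵐ`. Gaussians convolve to
Gaussians and the Gamma densities `t^{a-1}/Γ(a)` form a semigroup, which yields `R_s * R_{s'} =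
R_{s+s'}` on functions of `v` (`lintegral_rieszKernel_sub_mul_rieszKernel_vPart`). On `ℝᵐ`,
`R_s(v)` is an explicit multiple of `‖v‖^{s-m}` for `0 < s < m` (`rieszKernel_eq`). Hence the Riesz
potential of a power of `‖v‖` is a power of `‖v‖` with a constant given by Gamma functions
(`lintegral_rieszKernel_sub_mul_norm_vPart_rpow`).

*Schur's test.* Take the weight `‖v‖^{-m/(pp')}`. Its `p'`-th power `‖v‖^{-m/p}` is an
eigenfunction of the operator, its `p`-th power `‖v‖^{-m/p'}` is one of the transposed operator,
and both eigenvalues are the constant of the theorem (`rieszConst_div_rieszConst`). So the norm on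
`L^p` is at most that constant (`lintegral_lintegral_mul_rpow_le_of_schur`).
-/

/-! ### The heat kernel -/

section HeatKernel

variable {E : Type*} [NormedAddCommGroup E] [InnerProductSpace ℝ E]

/-- The heat kernel `(4πt)^{-d/2} exp(-‖v‖²/(4t))` of a `d`-dimensional Euclidean space. -/
noncomputable def heatKernel (t : ℝ) (v : E) : ℝ :=
  (4 * Real.pi * t) ^ (-(Module.finrank ℝ E / 2 : ℝ)) * Real.exp (-‖v‖ ^ 2 / (4 * t))

lemma heatKernel_nonneg {t : ℝ} (ht : 0 < t) (v : E) : 0 ≤ heatKernel t v := by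
  unfold heatKernel
  positivity

lemma heatKernel_sub_comm (t : ℝ) (v y : E) : heatKernel t (v - y) = heatKernel t (y - v) := by
  simp only [heatKernel, norm_sub_rev]

/-- Completing the square in the product of two Gaussians. -/
lemma heatKernel_sub_mul_heatKernel {t r : ℝ} (ht : 0 < t) (hr : 0 < r) (v y : E) :
    heatKernel t (v - y) * heatKernel r y =
      heatKernel (t + r) v * heatKernel (t * r / (t + r)) (y - (r / (t + r)) • v) := by
  have htr : 0 < t + r := by positivity
  have hsq : -‖v - y‖ ^ 2 / (4 * t) + -‖y‖ ^ 2 / (4 * r) = -‖v‖ ^ 2 / (4 * (t + r)) +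
      -‖y - (r / (t + r)) • v‖ ^ 2 / (4 * (t * r / (t + r))) := by
    rw [norm_sub_sq_real, norm_sub_sq_real, norm_smul, inner_smul_right, real_inner_comm,
      mul_pow, Real.norm_eq_abs, sq_abs]
    field_simp
    ring
  have hc : (4 * Real.pi * t) * (4 * Real.pi * r) =
      (4 * Real.pi * (t + r)) * (4 * Real.pi * (t * r / (t + r))) := by
    field_simp
  unfold heatKernel
  rw [mul_mul_mul_comm ((4 * Real.pi * t) ^ _), mul_mul_mul_comm ((4 * Real.pi * (t + r)) ^ _),
    ← Real.exp_add, ← Real.exp_add, hsq,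
    ← Real.mul_rpow (by positivity) (by positivity),
    ← Real.mul_rpow (by positivity) (by positivity), hc]

variable [MeasurableSpace E] [BorelSpace E]

@[fun_prop]
lemma Measurable.heatKernel {α : Type*} [MeasurableSpace α] {t : α → ℝ} {v : α → E}
    (ht : Measurable t) (hv : Measurable v) :
    Measurable fun a => heatKernel (t a) (v a) := by
  unfold _root_.heatKernel
  fun_prop

variable [FiniteDimensional ℝ E]

lemma integral_heatKernel {t : ℝ} (ht : 0 < t) : ∫ v : E, heatKernel t v = 1 := by
  unfold heatKernel
  have h := GaussianFourier.integral_rexp_neg_mul_sq_norm (V := E) (b := 1 / (4 * t))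
    (by positivity)
  have h' : ∀ v : E, -‖v‖ ^ 2 / (4 * t) = -(1 / (4 * t)) * ‖v‖ ^ 2 := fun v => by ring
  simp_rw [integral_const_mul, h', h]
  rw [show Real.pi / (1 / (4 * t)) = 4 * Real.pi * t by field_simp,
    ← Real.rpow_add (by positivity), neg_add_cancel, Real.rpow_zero]

lemma integrable_heatKernel {t : ℝ} (ht : 0 < t) :
    Integrable fun v : E => heatKernel t v :=
  .of_integral_ne_zero (by rw [integral_heatKernel ht]; exact one_ne_zero)

lemma lintegral_heatKernel {t : ℝ} (ht : 0 < t) :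
    ∫⁻ v : E, ENNReal.ofReal (heatKernel t v) = 1 := by
  rw [← ofReal_integral_eq_lintegral_ofReal (integrable_heatKernel ht)
    (ae_of_all _ fun v => heatKernel_nonneg ht v), integral_heatKernel ht, ENNReal.ofReal_one]

/-- The Gaussian integral against a plane wave, from the Fourier transform of a Gaussian. -/
lemma integral_heatKernel_sub_mul_cexp {t : ℝ} (ht : 0 < t) (w ξ : E) :
    ∫ y : E, (heatKernel t (w - y) : ℂ) *
        Complex.exp (2 * Real.pi * Complex.I * (inner ℝ y ξ : ℝ)) =
      Complex.exp (2 * Real.pi * Complex.I * (inner ℝ w ξ : ℝ)) *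
        (Real.exp (-(t * (2 * Real.pi * ‖ξ‖) ^ 2)) : ℝ) := by
  have hb : 0 < ((1 / (4 * t) : ℝ) : ℂ).re := by
    rw [Complex.ofReal_re]; positivity
  have h := GaussianFourier.integral_cexp_neg_mul_sq_norm_add (V := E) hb
    (2 * Real.pi * Complex.I) ξ
  have htC : (t : ℂ) ≠ 0 := by exact_mod_cast ht.ne'
  have hdim : ((Real.pi : ℂ) / ((1 / (4 * t) : ℝ) : ℂ)) ^ (Module.finrank ℝ E / 2 : ℂ) =
      (((4 * Real.pi * t) ^ (Module.finrank ℝ E / 2 : ℝ) : ℝ) : ℂ) := by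
    rw [Complex.ofReal_cpow (by positivity)]
    congr 1
    · push_cast; field_simp
    · push_cast; rfl
  rw [hdim] at h
  rw [← integral_add_right_eq_self _ w]
  have hint : ∀ y : E, (heatKernel t (w - (y + w)) : ℂ) *
        Complex.exp (2 * Real.pi * Complex.I * (inner ℝ (y + w) ξ : ℝ)) =
      (((4 * Real.pi * t) ^ (-(Module.finrank ℝ E / 2 : ℝ)) : ℝ) : ℂ) *
        Complex.exp (2 * Real.pi * Complex.I * (inner ℝ w ξ : ℝ)) *
        Complex.exp (-((1 / (4 * t) : ℝ) : ℂ) * ‖y‖ ^ 2 +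
          2 * Real.pi * Complex.I * (inner ℝ ξ y : ℝ)) := fun y => by
    have hexp : Complex.exp ((-‖y‖ ^ 2 / (4 * t) : ℝ) : ℂ) *
        Complex.exp (2 * Real.pi * Complex.I * (inner ℝ (y + w) ξ : ℝ)) =
        Complex.exp (2 * Real.pi * Complex.I * (inner ℝ w ξ : ℝ)) *
        Complex.exp (-((1 / (4 * t) : ℝ) : ℂ) * ‖y‖ ^ 2 +
          2 * Real.pi * Complex.I * (inner ℝ ξ y : ℝ)) := by
      rw [← Complex.exp_add, ← Complex.exp_add, inner_add_left, real_inner_comm ξ y]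
      congr 1
      push_cast
      field_simp
      ring
    rw [show w - (y + w) = -y by abel, heatKernel, norm_neg, Complex.ofReal_mul,
      Complex.ofReal_exp]
    linear_combination
      (((4 * Real.pi * t) ^ (-(Module.finrank ℝ E / 2 : ℝ)) : ℝ) : ℂ) * hexp
  simp_rw [hint]
  rw [integral_const_mul, h, Complex.ofReal_exp]
  have hone : (((4 * Real.pi * t) ^ (-(Module.finrank ℝ E / 2 : ℝ)) : ℝ) : ℂ) *
      (((4 * Real.pi * t) ^ (Module.finrank ℝ E / 2 : ℝ) : ℝ) : ℂ) = 1 := by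
    rw [← Complex.ofReal_mul, ← Real.rpow_add (by positivity), neg_add_cancel, Real.rpow_zero,
      Complex.ofReal_one]
  have hexp : (2 * Real.pi * Complex.I) ^ 2 * (‖ξ‖ : ℂ) ^ 2 / (4 * ((1 / (4 * t) : ℝ) : ℂ)) =
      ((-(t * (2 * Real.pi * ‖ξ‖) ^ 2) : ℝ) : ℂ) := by
    push_cast
    field_simp
    rw [Complex.I_sq]
    ring
  rw [hexp]
  linear_combination (Complex.exp (2 * Real.pi * Complex.I * (inner ℝ w ξ : ℝ)) *
    Complex.exp ((-(t * (2 * Real.pi * ‖ξ‖) ^ 2) : ℝ) : ℂ)) * hone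

end HeatKernel

/-! ### The Riesz kernel as a mixture of heat kernels -/

/-- The substitution `t = u s` in Euler's Beta integral. -/
lemma setLIntegral_Ioo_rpow_mul_sub_rpow {a b u : ℝ} (ha : 0 < a) (hb : 0 < b) (hu : 0 < u) :
    ∫⁻ t in Set.Ioo 0 u, ENNReal.ofReal (t ^ (a - 1) * (u - t) ^ (b - 1)) =
      ENNReal.ofReal (u ^ (a + b - 1) * ProbabilityTheory.beta a b) := by
  have himage : (fun s : ℝ => u * s) '' Set.Ioo 0 1 = Set.Ioo 0 u := by
    rw [Set.image_mul_left_Ioo hu, mul_zero, mul_one]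
  have hbeta := ProbabilityTheory.beta_pos ha hb
  have hpdf := ProbabilityTheory.lintegral_betaPDF_eq_one ha hb
  rw [ProbabilityTheory.lintegral_betaPDF] at hpdf
  rw [← himage, lintegral_image_eq_lintegral_abs_deriv_mul measurableSet_Ioo
    (fun s _ => ((hasDerivAt_id' s).const_mul u).hasDerivWithinAt)
    (mul_right_injective₀ hu.ne').injOn]
  calc
    _ = ∫⁻ s in Set.Ioo (0 : ℝ) 1,
        ENNReal.ofReal (u ^ (a + b - 1) * ProbabilityTheory.beta a b) *
        ENNReal.ofReal (1 / ProbabilityTheory.beta a b * s ^ (a - 1) * (1 - s) ^ (b - 1)) := by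
      refine setLIntegral_congr_fun measurableSet_Ioo fun s hs => ?_
      have hs' : 0 < 1 - s := sub_pos.2 hs.2
      rw [← ENNReal.ofReal_mul (abs_nonneg _), ← ENNReal.ofReal_mul (by positivity), mul_one,
        abs_of_pos hu, show u - u * s = u * (1 - s) by ring,
        Real.mul_rpow hu.le hs.1.le, Real.mul_rpow hu.le hs'.le]
      have hpow : u ^ (a + b - 1) = u * (u ^ (a - 1) * u ^ (b - 1)) := by
        rw [← Real.rpow_add hu, show a + b - 1 = 1 + (a - 1 + (b - 1)) by ring,
          Real.rpow_add hu 1, Real.rpow_one]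
      congr 1
      rw [hpow]
      field_simp
    _ = _ := by rw [lintegral_const_mul _ (by fun_prop), hpdf, mul_one]

/-- The Gamma densities `t^{a-1}/Γ(a)` form a convolution semigroup on `(0, ∞)`. -/
lemma lintegral_gamma_convolution {a b : ℝ} (ha : 0 < a) (hb : 0 < b) {φ : ℝ → ℝ≥0∞}
    (hφ : Measurable φ) :
    ∫⁻ t in Set.Ioi 0, ∫⁻ r in Set.Ioi 0, ENNReal.ofReal (t ^ (a - 1) / Real.Gamma a) *
        ENNReal.ofReal (r ^ (b - 1) / Real.Gamma b) * φ (t + r) =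
      ∫⁻ u in Set.Ioi 0, ENNReal.ofReal (u ^ (a + b - 1) / Real.Gamma (a + b)) * φ u := by
  have hΓa := Real.Gamma_pos_of_pos ha
  have hΓb := Real.Gamma_pos_of_pos hb
  set D : ℝ → ℝ → ℝ≥0∞ := fun t u => ENNReal.ofReal (t ^ (a - 1) / Real.Gamma a) *
    ENNReal.ofReal ((u - t) ^ (b - 1) / Real.Gamma b) * φ u
  have hD : Measurable (Function.uncurry D) := by
    simp only [D, Function.uncurry_def]
    fun_prop
  calc
    _ = ∫⁻ t in Set.Ioi 0, ∫⁻ u, (Set.Ioi t).indicator (D t) u := by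
      refine setLIntegral_congr_fun measurableSet_Ioi fun t _ => ?_
      rw [← lintegral_indicator measurableSet_Ioi,
        ← lintegral_sub_right_eq_self _ t]
      refine lintegral_congr fun u => ?_
      by_cases h : t < u <;> simp [Set.indicator, h, D]
    _ = ∫⁻ t, ∫⁻ u, {q : ℝ × ℝ | 0 < q.1 ∧ q.1 < q.2}.indicator (Function.uncurry D) (t, u) := by
      rw [← lintegral_indicator measurableSet_Ioi]
      refine lintegral_congr fun t => ?_
      by_cases ht : 0 < t <;> simp [Set.indicator, ht, Function.uncurry]
    _ = ∫⁻ u, ∫⁻ t, {q : ℝ × ℝ | 0 < q.1 ∧ q.1 < q.2}.indicator (Function.uncurry D) (t, u) := by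
      refine lintegral_lintegral_swap (Measurable.aemeasurable ?_)
      refine (hD.indicator ?_)
      exact (measurableSet_lt measurable_const measurable_fst).inter
        (measurableSet_lt measurable_fst measurable_snd)
    _ = ∫⁻ u in Set.Ioi 0, ∫⁻ t in Set.Ioo 0 u, D t u := by
      rw [← lintegral_indicator measurableSet_Ioi]
      refine lintegral_congr fun u => ?_
      by_cases hu : 0 < u
      · rw [Set.indicator_of_mem (Set.mem_Ioi.2 hu), ← lintegral_indicator measurableSet_Ioo]
        rfl
      · rw [Set.indicator_of_notMem (by simpa using hu)]
        rw [lintegral_eq_zero_of_ae_eq_zero (ae_of_all _ fun t => ?_)]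
        refine Set.indicator_of_notMem ?_ _
        rintro ⟨h1, h2⟩
        exact hu (h1.trans h2)
    _ = _ := by
      refine setLIntegral_congr_fun measurableSet_Ioi fun u hu => ?_
      have hu : 0 < u := hu
      have hΓab := Real.Gamma_pos_of_pos (add_pos ha hb)
      calc
        _ = ∫⁻ t in Set.Ioo 0 u, ENNReal.ofReal (1 / (Real.Gamma a * Real.Gamma b)) * φ u *
            ENNReal.ofReal (t ^ (a - 1) * (u - t) ^ (b - 1)) := by
          refine setLIntegral_congr_fun measurableSet_Ioo fun t ht => ?_
          have ht' : 0 < t := ht.1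
          have hut : 0 < u - t := sub_pos.2 ht.2
          simp only [D]
          rw [mul_right_comm (ENNReal.ofReal (1 / _)), ← ENNReal.ofReal_mul (by positivity),
            ← ENNReal.ofReal_mul (by positivity)]
          congr 2
          field_simp
        _ = _ := by
          rw [lintegral_const_mul _ (by fun_prop), setLIntegral_Ioo_rpow_mul_sub_rpow ha hb hu,
            mul_right_comm, ← ENNReal.ofReal_mul (by positivity), ProbabilityTheory.beta]
          congr 2
          field_simp

section RieszKernel

variable {E : Type*} [NormedAddCommGroup E] [InnerProductSpace ℝ E]

/-- The Riesz kernel of order `s`, the convolution kernel of `(-Δ)^{-s/2}`, written as the mixture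
`Γ(s/2)⁻¹ ∫₀^∞ t^{s/2-1} G_t dt` of heat kernels. With values in `[0, ∞]` it makes sense for all
`s` and at every point. -/
noncomputable def rieszKernel (s : ℝ) (v : E) : ℝ≥0∞ :=
  ∫⁻ t in Set.Ioi 0, ENNReal.ofReal (t ^ (s / 2 - 1) / Real.Gamma (s / 2)) *
    ENNReal.ofReal (heatKernel t v)

/-- The constant `k` for which the Riesz kernel of order `s` on `ℝᵈ` is `k ‖v‖^{s-d}`. -/
noncomputable def rieszConst (d s : ℝ) : ℝ :=
  Real.Gamma ((d - s) / 2) / (Real.Gamma (s / 2) * 2 ^ s * Real.pi ^ (d / 2))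

lemma rieszConst_pos {d s : ℝ} (hs : 0 < s) (hsd : s < d) : 0 < rieszConst d s := by
  have := Real.Gamma_pos_of_pos (half_pos hs)
  have := Real.Gamma_pos_of_pos (half_pos (sub_pos.2 hsd))
  unfold rieszConst
  positivity

/-- A Gamma integral in the variable `1/t`. -/
lemma integral_rpow_mul_exp_neg_div {A c : ℝ} (hA : 0 < A) (hc : 0 < c) :
    ∫ t in Set.Ioi 0, t ^ (-A - 1) * Real.exp (-(c / t)) = c ^ (-A) * Real.Gamma A := by
  rw [Real.rpow_neg hc.le, ← Real.inv_rpow hc.le, ← one_div,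
    ← Real.integral_rpow_mul_exp_neg_mul_Ioi hA hc,
    ← integral_comp_rpow_Ioi (fun x => x ^ (A - 1) * Real.exp (-(c * x)))
      (by norm_num : (-1 : ℝ) ≠ 0)]
  refine setIntegral_congr_fun measurableSet_Ioi fun t ht => ?_
  have ht : 0 < t := ht
  simp only [smul_eq_mul, abs_neg, abs_one, one_mul, ← Real.rpow_mul ht.le]
  rw [← mul_assoc, ← Real.rpow_add ht, Real.rpow_neg_one, div_eq_mul_inv]
  ring_nf

lemma rieszKernel_eq {s : ℝ} (hs : 0 < s) (hsd : s < Module.finrank ℝ E) {v : E} (hv : v ≠ 0) :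
    rieszKernel s v = ENNReal.ofReal
      (rieszConst (Module.finrank ℝ E) s * ‖v‖ ^ (s - Module.finrank ℝ E)) := by
  set d : ℝ := (Module.finrank ℝ E : ℝ) with hd
  have hv' : 0 < ‖v‖ := norm_pos_iff.2 hv
  have hA : 0 < (d - s) / 2 := half_pos (sub_pos.2 hsd)
  have hΓ := Real.Gamma_pos_of_pos (half_pos hs)
  have hΓA := Real.Gamma_pos_of_pos hA
  have hc : 0 < ‖v‖ ^ 2 / 4 := by positivity
  have hint := integral_rpow_mul_exp_neg_div hA hc
  have hintegrable : Integrable (fun t : ℝ => t ^ (-((d - s) / 2) - 1) *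
      Real.exp (-(‖v‖ ^ 2 / 4 / t))) (volume.restrict (Set.Ioi 0)) :=
    .of_integral_ne_zero (by rw [hint]; positivity)
  have hC : 0 ≤ (4 * Real.pi) ^ (-(d / 2)) / Real.Gamma (s / 2) := by positivity
  calc
    _ = ∫⁻ t in Set.Ioi 0, ENNReal.ofReal ((4 * Real.pi) ^ (-(d / 2)) / Real.Gamma (s / 2)) *
        ENNReal.ofReal (t ^ (-((d - s) / 2) - 1) * Real.exp (-(‖v‖ ^ 2 / 4 / t))) := by
      refine setLIntegral_congr_fun measurableSet_Ioi fun t ht => ?_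
      have ht : 0 < t := ht
      rw [← ENNReal.ofReal_mul (by positivity), ← ENNReal.ofReal_mul hC, heatKernel, ← hd,
        Real.mul_rpow (by positivity) ht.le,
        show -((d - s) / 2) - 1 = (s / 2 - 1) + (-(d / 2)) by ring, Real.rpow_add ht,
        show -‖v‖ ^ 2 / (4 * t) = -(‖v‖ ^ 2 / 4 / t) by field_simp]
      congr 1
      ring
    _ = ENNReal.ofReal ((4 * Real.pi) ^ (-(d / 2)) / Real.Gamma (s / 2) *
        ((‖v‖ ^ 2 / 4) ^ (-((d - s) / 2)) * Real.Gamma ((d - s) / 2))) := by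
      rw [lintegral_const_mul _ (by fun_prop), ← ofReal_integral_eq_lintegral_ofReal hintegrable,
        hint, ENNReal.ofReal_mul hC]
      filter_upwards [ae_restrict_mem measurableSet_Ioi] with t ht
      have ht : 0 < t := ht
      positivity
    _ = _ := by
      have hnorm : (‖v‖ ^ 2) ^ (-((d - s) / 2)) = ‖v‖ ^ (s - d) := by
        rw [← Real.rpow_natCast ‖v‖ 2, ← Real.rpow_mul hv'.le]
        congr 1
        push_cast
        ring
      have hfour : (4 : ℝ) ^ (-(d / 2)) / 4 ^ (-((d - s) / 2)) * 2 ^ s = 1 := by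
        rw [show (4 : ℝ) = 2 ^ (2 : ℝ) by norm_num, ← Real.rpow_mul (by norm_num),
          ← Real.rpow_mul (by norm_num), ← Real.rpow_sub (by norm_num),
          ← Real.rpow_add (by norm_num)]
        ring_nf
        exact Real.rpow_zero 2
      rw [Real.div_rpow (by positivity) (by norm_num), hnorm,
        Real.mul_rpow (by norm_num) Real.pi_pos.le, rieszConst, Real.rpow_neg Real.pi_pos.le]
      congr 1
      rw [eq_comm, div_mul_eq_mul_div, div_eq_iff (by positivity)]
      field_simp at hfour ⊢
      linear_combination (-1 : ℝ) * hfour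

end RieszKernel

section RieszKernel

variable {E : Type*} [NormedAddCommGroup E] [InnerProductSpace ℝ E] [MeasurableSpace E]
  [BorelSpace E]

@[fun_prop]
lemma Measurable.rieszKernel [SecondCountableTopology E] {α : Type*} [MeasurableSpace α] {s : ℝ}
    {v : α → E} (hv : Measurable v) : Measurable fun a => rieszKernel s (v a) := by
  unfold _root_.rieszKernel
  refine Measurable.lintegral_prod_right' (f := fun q : α × ℝ =>
    ENNReal.ofReal (q.2 ^ (s / 2 - 1) / Real.Gamma (s / 2)) *
      ENNReal.ofReal (_root_.heatKernel q.2 (v q.1))) ?_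
  fun_prop

end RieszKernel

/-! ### Integrating out the variables `x` -/

section Product

variable {n m : ℕ}

/-- The component `x ∈ ℝⁿ` of a point `w = (x, v)` of `ℝⁿ × ℝᵐ`. -/
def xPart (w : ProductSpace n m) : EuclideanSpace ℝ (Fin n) :=
  WithLp.toLp 2 fun i => w (Sum.inl i)

lemma xPart_sub (w y : ProductSpace n m) : xPart (w - y) = xPart w - xPart y := rfl

lemma vPart_sub (w y : ProductSpace n m) : vPart (w - y) = vPart w - vPart y := rfl

@[fun_prop]
lemma measurable_vPart : Measurable (vPart : ProductSpace n m → _) := by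
  unfold vPart
  fun_prop

lemma norm_sq_eq_xPart_add_vPart (w : ProductSpace n m) :
    ‖w‖ ^ 2 = ‖xPart w‖ ^ 2 + ‖vPart w‖ ^ 2 := by
  simp [EuclideanSpace.norm_sq_eq, xPart, vPart]

lemma heatKernel_eq_mul {t : ℝ} (ht : 0 < t) (w : ProductSpace n m) :
    heatKernel t w = heatKernel t (xPart w) * heatKernel t (vPart w) := by
  simp only [heatKernel, finrank_euclideanSpace, Fintype.card_sum, Fintype.card_fin]
  rw [norm_sq_eq_xPart_add_vPart, mul_mul_mul_comm, ← Real.exp_add,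
    ← Real.rpow_add (by positivity)]
  push_cast
  ring_nf

lemma measurePreserving_xPart_vPart :
    MeasurePreserving fun w : ProductSpace n m => (xPart w, vPart w) :=
  ((PiLp.volume_preserving_toLp (Fin n)).prod (PiLp.volume_preserving_toLp (Fin m))).comp
    ((volume_measurePreserving_sumPiEquivProdPi fun _ : Fin n ⊕ Fin m => ℝ).comp
      (PiLp.volume_preserving_ofLp (Fin n ⊕ Fin m)))

lemma lintegral_xPart_mul_vPart {F : EuclideanSpace ℝ (Fin n) → ℝ≥0∞}
    {H : EuclideanSpace ℝ (Fin m) → ℝ≥0∞} (hF : Measurable F) (hH : Measurable H) :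
    ∫⁻ w : ProductSpace n m, F (xPart w) * H (vPart w) = (∫⁻ x, F x) * ∫⁻ v, H v := by
  rw [← lintegral_prod_mul hF.aemeasurable hH.aemeasurable]
  exact measurePreserving_xPart_vPart.lintegral_comp
    (f := fun q : EuclideanSpace ℝ (Fin n) × EuclideanSpace ℝ (Fin m) => F q.1 * H q.2)
    (by fun_prop)

lemma ae_vPart_ne_zero (hm : 0 < m) : ∀ᵐ w : ProductSpace n m, vPart w ≠ 0 := by
  have : Nonempty (Fin m) := ⟨⟨0, hm⟩⟩
  have h : ∀ᵐ q : EuclideanSpace ℝ (Fin n) × EuclideanSpace ℝ (Fin m), q.2 ≠ 0 :=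
    Measure.quasiMeasurePreserving_snd.ae
      (Measure.ae_ne (volume : Measure (EuclideanSpace ℝ (Fin m))) 0)
  exact measurePreserving_xPart_vPart.quasiMeasurePreserving.ae h

/-- The heat semigroup of `ℝⁿ⁺ᵐ` acts on functions of `v` alone as the heat semigroup of `ℝᵐ`. -/
lemma lintegral_heatKernel_sub_mul_heatKernel_vPart {t r : ℝ} (ht : 0 < t) (hr : 0 < r)
    (w : ProductSpace n m) :
    ∫⁻ y : ProductSpace n m, ENNReal.ofReal (heatKernel t (w - y)) *
        ENNReal.ofReal (heatKernel r (vPart y)) =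
      ENNReal.ofReal (heatKernel (t + r) (vPart w)) := by
  have hτ : 0 < t * r / (t + r) := by positivity
  calc
    _ = ∫⁻ y : ProductSpace n m, ENNReal.ofReal (heatKernel t (xPart w - xPart y)) *
        (ENNReal.ofReal (heatKernel (t + r) (vPart w)) *
          ENNReal.ofReal (heatKernel (t * r / (t + r)) (vPart y - (r / (t + r)) • vPart w))) := by
      refine lintegral_congr fun y => ?_
      rw [← ENNReal.ofReal_mul (heatKernel_nonneg ht _),
        ← ENNReal.ofReal_mul (heatKernel_nonneg (add_pos ht hr) _),
        ← ENNReal.ofReal_mul (heatKernel_nonneg ht _), heatKernel_eq_mul ht, xPart_sub, vPart_sub,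
        mul_assoc, heatKernel_sub_mul_heatKernel ht hr]
    _ = (∫⁻ x, ENNReal.ofReal (heatKernel t (xPart w - x))) *
        ∫⁻ v, ENNReal.ofReal (heatKernel (t + r) (vPart w)) *
          ENNReal.ofReal (heatKernel (t * r / (t + r)) (v - (r / (t + r)) • vPart w)) :=
      lintegral_xPart_mul_vPart (F := fun x => ENNReal.ofReal (heatKernel t (xPart w - x)))
        (H := fun v => ENNReal.ofReal (heatKernel (t + r) (vPart w)) *
          ENNReal.ofReal (heatKernel (t * r / (t + r)) (v - (r / (t + r)) • vPart w)))
        (by fun_prop) (by fun_prop)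
    _ = _ := by
      rw [lintegral_const_mul _ (by fun_prop),
        lintegral_sub_right_eq_self (fun v => ENNReal.ofReal (heatKernel (t * r / (t + r)) v)),
        lintegral_sub_left_eq_self (fun v => ENNReal.ofReal (heatKernel t v)),
        lintegral_heatKernel ht, lintegral_heatKernel hτ, one_mul, mul_one]

/-- The composition law of Riesz potentials, for a function of `v` alone: the potential of
order `s` on `ℝⁿ⁺ᵐ` acts on it as the one on `ℝᵐ`. -/
lemma lintegral_rieszKernel_sub_mul_rieszKernel_vPart {s s' : ℝ} (hs : 0 < s) (hs' : 0 < s')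
    (w : ProductSpace n m) :
    ∫⁻ y : ProductSpace n m, rieszKernel s (w - y) * rieszKernel s' (vPart y) =
      rieszKernel (s + s') (vPart w) := by
  set A : ℝ → ℝ≥0∞ := fun t => ENNReal.ofReal (t ^ (s / 2 - 1) / Real.Gamma (s / 2)) with hA
  set B : ℝ → ℝ≥0∞ := fun t => ENNReal.ofReal (t ^ (s' / 2 - 1) / Real.Gamma (s' / 2)) with hB
  have hAm : Measurable A := by fun_prop
  have hBm : Measurable B := by fun_prop
  calc
    _ = ∫⁻ y : ProductSpace n m, ∫⁻ t in Set.Ioi 0, ∫⁻ r in Set.Ioi 0, A t * B r *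
        (ENNReal.ofReal (heatKernel t (w - y)) * ENNReal.ofReal (heatKernel r (vPart y))) := by
      refine lintegral_congr fun y => ?_
      rw [rieszKernel, rieszKernel, ← lintegral_mul_const _ (by fun_prop)]
      refine lintegral_congr fun t => ?_
      rw [← lintegral_const_mul _ (by fun_prop)]
      refine lintegral_congr fun r => ?_
      rw [mul_mul_mul_comm]
    _ = ∫⁻ t in Set.Ioi 0, ∫⁻ y : ProductSpace n m, ∫⁻ r in Set.Ioi 0, A t * B r *
        (ENNReal.ofReal (heatKernel t (w - y)) * ENNReal.ofReal (heatKernel r (vPart y))) := by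
      refine lintegral_lintegral_swap (Measurable.aemeasurable ?_)
      refine Measurable.lintegral_prod_right' (f := fun q : (ProductSpace n m × ℝ) × ℝ =>
        A q.1.2 * B q.2 * (ENNReal.ofReal (heatKernel q.1.2 (w - q.1.1)) *
          ENNReal.ofReal (heatKernel q.2 (vPart q.1.1)))) ?_
      fun_prop
    _ = ∫⁻ t in Set.Ioi 0, ∫⁻ r in Set.Ioi 0, ∫⁻ y : ProductSpace n m, A t * B r *
        (ENNReal.ofReal (heatKernel t (w - y)) * ENNReal.ofReal (heatKernel r (vPart y))) := by
      refine lintegral_congr fun t => ?_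
      refine lintegral_lintegral_swap (Measurable.aemeasurable ?_)
      fun_prop
    _ = ∫⁻ t in Set.Ioi 0, ∫⁻ r in Set.Ioi 0, A t * B r *
        ENNReal.ofReal (heatKernel (t + r) (vPart w)) := by
      refine setLIntegral_congr_fun measurableSet_Ioi fun t ht => ?_
      refine setLIntegral_congr_fun measurableSet_Ioi fun r hr => ?_
      rw [lintegral_const_mul _ (by fun_prop),
        lintegral_heatKernel_sub_mul_heatKernel_vPart ht hr]
    _ = _ := by
      rw [lintegral_gamma_convolution (half_pos hs) (half_pos hs')
        (φ := fun u => ENNReal.ofReal (heatKernel u (vPart w))) (by fun_prop), rieszKernel,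
        add_div]

/-- The Riesz potential of order `s` of the power `‖v‖^a` is a multiple of `‖v‖^{s+a}`. -/
lemma lintegral_rieszKernel_sub_mul_norm_vPart_rpow {s a : ℝ} (hs : 0 < s) (ha : -m < a)
    (hsa : s + a < 0) (w : ProductSpace n m) (hw : vPart w ≠ 0) :
    ∫⁻ y : ProductSpace n m, rieszKernel s (w - y) * ENNReal.ofReal (‖vPart y‖ ^ a) =
      ENNReal.ofReal (rieszConst m (s + (m + a)) / rieszConst m (m + a) *
        ‖vPart w‖ ^ (s + a)) := by
  have hm : (0 : ℝ) < m := by linarith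
  have hk : 0 < rieszConst m (m + a) := rieszConst_pos (by linarith) (by linarith)
  have hk' : 0 < rieszConst m (s + (m + a)) := rieszConst_pos (by linarith) (by linarith)
  have hpow : ∀ s' : ℝ, 0 < s' → s' < m → ∀ v : EuclideanSpace ℝ (Fin m), v ≠ 0 →
      rieszKernel s' v = ENNReal.ofReal (rieszConst m s' * ‖v‖ ^ (s' - m)) := by
    intro s' h0 h1 v hv
    have h := rieszKernel_eq (E := EuclideanSpace ℝ (Fin m)) h0
      (by rwa [finrank_euclideanSpace, Fintype.card_fin]) hv
    rwa [finrank_euclideanSpace, Fintype.card_fin] at h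
  calc
    _ = ∫⁻ y : ProductSpace n m, ENNReal.ofReal (rieszConst m (m + a))⁻¹ *
        (rieszKernel s (w - y) * rieszKernel (m + a) (vPart y)) := by
      refine lintegral_congr_ae ?_
      filter_upwards [ae_vPart_ne_zero (by exact_mod_cast hm)] with y hy
      rw [hpow _ (by linarith) (by linarith) _ hy, mul_left_comm,
        ← ENNReal.ofReal_mul (by positivity), add_sub_cancel_left, inv_mul_cancel_left₀ hk.ne']
    _ = _ := by
      rw [lintegral_const_mul _ (by fun_prop),
        lintegral_rieszKernel_sub_mul_rieszKernel_vPart hs (by linarith),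
        hpow _ (by linarith) (by linarith) _ hw, ← ENNReal.ofReal_mul (by positivity),
        show s + (m + a) - m = s + a by ring]
      congr 1
      ring

end Product

/-! ### Recovering a Schwartz function from its fractional Laplacian -/

section Representation

variable {E : Type*} [NormedAddCommGroup E] [InnerProductSpace ℝ E]

/-- The plane wave `e^{2πi⟨ξ, w⟩}`. -/
noncomputable def planeWave (ξ w : E) : ℂ :=
  Complex.exp (((2 * Real.pi * inner ℝ ξ w : ℝ) : ℂ) * Complex.I)

lemma norm_planeWave (ξ w : E) : ‖planeWave ξ w‖ = 1 :=
  Complex.norm_exp_ofReal_mul_I _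

lemma continuous_planeWave : Continuous fun q : E × E => planeWave q.1 q.2 := by
  unfold planeWave
  fun_prop

variable [FiniteDimensional ℝ E] [MeasurableSpace E] [BorelSpace E]

lemma fourierInv_eq_integral_planeWave (F : E → ℂ) (w : E) :
    𝓕⁻ F w = ∫ ξ, planeWave ξ w * F ξ := by
  rw [Real.fourierInv_eq']
  rfl

lemma continuous_fourierInv {F : E → ℂ} (hF : Integrable F) : Continuous (𝓕⁻ F) := by
  have h : Continuous (𝓕 F) := VectorFourier.fourierIntegral_continuous
    Real.continuous_fourierChar (innerSL ℝ).continuous₂ hF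
  have h' : 𝓕⁻ F = fun w => 𝓕 F (-w) := funext fun w => Real.fourierInv_eq_fourier_neg F w
  rw [h']
  exact h.comp continuous_neg

lemma integrable_norm_rpow_mul_fourier {γ : ℝ} (hγ : 0 ≤ γ) (g : 𝓢(E, ℂ)) :
    Integrable fun ξ : E => (((2 * Real.pi * ‖ξ‖) ^ γ : ℝ) : ℂ) * 𝓕 (g : E → ℂ) ξ := by
  have hcont : Continuous (𝓕 (g : E → ℂ)) := (𝓕 g).continuous
  have hk := (𝓕 g).integrable_pow_mul volume ⌈γ⌉₊
  have h0 := ((𝓕 g).integrable (μ := volume)).norm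
  refine (h0.add (hk.const_mul ((2 * Real.pi) ^ ⌈γ⌉₊))).mono' ?_ (ae_of_all _ fun ξ => ?_)
  · refine Continuous.aestronglyMeasurable (Continuous.mul ?_ hcont)
    refine Complex.continuous_ofReal.comp (Continuous.rpow_const (by fun_prop) fun _ => .inr hγ)
  · have hx : 0 ≤ 2 * Real.pi * ‖ξ‖ := by positivity
    have hle : (2 * Real.pi * ‖ξ‖) ^ γ ≤ 1 + (2 * Real.pi * ‖ξ‖) ^ ⌈γ⌉₊ := by
      rcases le_total (2 * Real.pi * ‖ξ‖) 1 with h | h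
      · exact (Real.rpow_le_one hx h hγ).trans (le_add_of_nonneg_right (by positivity))
      · rw [← Real.rpow_natCast]
        exact (Real.rpow_le_rpow_of_exponent_le h (Nat.le_ceil γ)).trans
          (le_add_of_nonneg_left zero_le_one)
    rw [norm_mul, Complex.norm_real, Real.norm_of_nonneg (by positivity)]
    calc
      _ ≤ (1 + (2 * Real.pi * ‖ξ‖) ^ ⌈γ⌉₊) * ‖𝓕 (g : E → ℂ) ξ‖ := by gcongr
      _ = _ := by
        simp only [Pi.add_apply, SchwartzMap.fourier_coe]
        ring

/-- The heat semigroup multiplies the Fourier transform by `e^{-t(2π‖ξ‖)²}`. -/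
lemma integral_heatKernel_sub_mul_fourierInv {F : E → ℂ} (hF : Integrable F) {t : ℝ} (ht : 0 < t)
    (w : E) :
    ∫ y : E, (heatKernel t (w - y) : ℂ) * 𝓕⁻ F y =
      ∫ ξ, planeWave ξ w * ((Real.exp (-(t * (2 * Real.pi * ‖ξ‖) ^ 2)) : ℝ) * F ξ) := by
  have hG : Integrable fun y : E => (heatKernel t (w - y) : ℂ) :=
    ((integrable_heatKernel ht).comp_sub_left w).ofReal
  have hint : Integrable (fun q : E × E =>
      planeWave q.2 q.1 * ((heatKernel t (w - q.1) : ℂ) * F q.2)) (volume.prod volume) :=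
    (hG.mul_prod hF).bdd_mul (c := 1)
      (continuous_planeWave.comp continuous_swap).aestronglyMeasurable
      (ae_of_all _ fun q => (norm_planeWave _ _).le)
  calc
    _ = ∫ y : E, ∫ ξ, planeWave ξ y * ((heatKernel t (w - y) : ℂ) * F ξ) := by
      refine integral_congr_ae (ae_of_all _ fun y => ?_)
      dsimp only
      rw [fourierInv_eq_integral_planeWave, ← integral_const_mul]
      refine integral_congr_ae (ae_of_all _ fun ξ => ?_)
      dsimp only
      ring
    _ = ∫ ξ, ∫ y : E, planeWave ξ y * ((heatKernel t (w - y) : ℂ) * F ξ) :=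
      integral_integral_swap hint
    _ = _ := by
      refine integral_congr_ae (ae_of_all _ fun ξ => ?_)
      have h := integral_heatKernel_sub_mul_cexp ht w ξ
      have hwave : ∀ y : E, planeWave ξ y =
          Complex.exp (2 * Real.pi * Complex.I * (inner ℝ y ξ : ℝ)) := fun y => by
        rw [planeWave, real_inner_comm]
        congr 1
        push_cast
        ring
      simp_rw [hwave] at h ⊢
      rw [← mul_assoc, ← h, ← integral_mul_const]
      refine integral_congr_ae (ae_of_all _ fun y => ?_)
      dsimp only
      ring

/-- Fourier inversion together with `q^{γ/2} Γ(γ/2)⁻¹ ∫₀^∞ t^{γ/2-1} e^{-tq} dt = 1` for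
`q = (2π‖ξ‖)²`: a Schwartz function is the superposition over `t` of the heat flow of its
fractional Laplacian of order `γ`. -/
lemma eq_integral_heatKernel_fracLaplacian [Nontrivial E] {γ : ℝ} (hγ : 0 < γ) (g : 𝓢(E, ℂ))
    (w : E) :
    g w = ∫ t in Set.Ioi 0, ((t ^ (γ / 2 - 1) / Real.Gamma (γ / 2) : ℝ) : ℂ) *
      ∫ y : E, (heatKernel t (w - y) : ℂ) * fracLaplacian (γ / 2) g y := by
  have hΓ := Real.Gamma_pos_of_pos (half_pos hγ)
  set F : E → ℂ := fun ξ => (((2 * Real.pi * ‖ξ‖) ^ γ : ℝ) : ℂ) * 𝓕 (g : E → ℂ) ξ with hF_def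
  have hF : Integrable F := integrable_norm_rpow_mul_fourier hγ.le g
  have hfrac : fracLaplacian (γ / 2) g = 𝓕⁻ F := by
    rw [fracLaplacian, mul_div_cancel₀ γ two_ne_zero]
  set c : E → ℝ → ℝ := fun ξ t => t ^ (γ / 2 - 1) / Real.Gamma (γ / 2) *
    Real.exp (-(t * (2 * Real.pi * ‖ξ‖) ^ 2)) with hc_def
  have hc_nonneg : ∀ ξ, ∀ t ∈ Set.Ioi (0 : ℝ), 0 ≤ c ξ t := by
    intro ξ t ht
    have ht : 0 < t := ht
    positivity
  have hc_int : ∀ ξ : E, ξ ≠ 0 → ∫ t in Set.Ioi 0, c ξ t = ((2 * Real.pi * ‖ξ‖) ^ γ)⁻¹ := by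
    intro ξ hξ
    have hξ' : 0 < ‖ξ‖ := norm_pos_iff.2 hξ
    have hq : 0 < (2 * Real.pi * ‖ξ‖) ^ 2 := by positivity
    have h := Real.integral_rpow_mul_exp_neg_mul_Ioi (half_pos hγ) hq
    have heq : ∀ t : ℝ, c ξ t = (Real.Gamma (γ / 2))⁻¹ *
        (t ^ (γ / 2 - 1) * Real.exp (-((2 * Real.pi * ‖ξ‖) ^ 2 * t))) := fun t => by
      simp only [hc_def]
      rw [mul_comm t]
      ring
    simp_rw [heq]
    rw [integral_const_mul, h, one_div, Real.inv_rpow hq.le, ← Real.rpow_natCast _ 2,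
      ← Real.rpow_mul (by positivity)]
    rw [show ((2 : ℕ) : ℝ) * (γ / 2) = γ by push_cast; ring]
    field_simp
  -- At `ξ = 0` the multiplier vanishes and cannot be inverted; this is where `E ≠ 0` is needed.
  have hne : ∀ᵐ ξ : E, ξ ≠ 0 := Measure.ae_ne volume 0
  have hint : Integrable (fun q : ℝ × E => planeWave q.2 w * ((c q.2 q.1 : ℂ) * F q.2))
      ((volume.restrict (Set.Ioi 0)).prod volume) := by
    have hFm : AEStronglyMeasurable (fun q : ℝ × E => F q.2)
        ((volume.restrict (Set.Ioi 0)).prod volume) := hF.aestronglyMeasurable.comp_snd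
    have hpw : Continuous fun q : ℝ × E => planeWave q.2 w := by
      unfold planeWave
      fun_prop
    refine Integrable.bdd_mul (c := 1) ?_ hpw.aestronglyMeasurable
      (ae_of_all _ fun q => (norm_planeWave _ _).le)
    have hcm : Measurable fun q : ℝ × E => (c q.2 q.1 : ℂ) := by
      simp only [hc_def]
      fun_prop
    refine (integrable_prod_iff' (hcm.aestronglyMeasurable.mul hFm)).2 ⟨?_, ?_⟩
    · filter_upwards [hne] with ξ hξ
      have hξ' : 0 < ‖ξ‖ := norm_pos_iff.2 hξ
      have hci : Integrable (c ξ) (volume.restrict (Set.Ioi 0)) :=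
        .of_integral_ne_zero (by rw [hc_int ξ hξ]; positivity)
      exact (hci.ofReal (𝕜 := ℂ)).mul_const (F ξ)
    · refine (𝓕 g).integrable.norm.congr ?_
      filter_upwards [hne] with ξ hξ
      have hξ' : 0 < ‖ξ‖ := norm_pos_iff.2 hξ
      have hnorm : ∫ t in Set.Ioi 0, ‖(c ξ t : ℂ) * F ξ‖ =
          (∫ t in Set.Ioi 0, c ξ t) * ‖F ξ‖ := by
        rw [← integral_mul_const]
        refine setIntegral_congr_fun measurableSet_Ioi fun t ht => ?_
        rw [norm_mul, Complex.norm_real, Real.norm_of_nonneg (hc_nonneg ξ t ht)]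
      refine Eq.trans ?_ hnorm.symm
      rw [hc_int ξ hξ, hF_def, norm_mul, Complex.norm_real,
        Real.norm_of_nonneg (by positivity), inv_mul_cancel_left₀ (by positivity),
        SchwartzMap.fourier_coe]
  have hinv : 𝓕⁻ (𝓕 (g : E → ℂ)) w = g w :=
    congrFun (g.continuous.fourierInv_fourier_eq g.integrable (𝓕 g).integrable) w
  calc
    _ = ∫ ξ, planeWave ξ w * 𝓕 (g : E → ℂ) ξ := by
      rw [← fourierInv_eq_integral_planeWave, hinv]
    _ = ∫ ξ, ∫ t in Set.Ioi 0, planeWave ξ w * ((c ξ t : ℂ) * F ξ) := by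
      refine integral_congr_ae ?_
      filter_upwards [hne] with ξ hξ
      have hξ' : 0 < ‖ξ‖ := norm_pos_iff.2 hξ
      have hpos : ((2 * Real.pi * ‖ξ‖) ^ γ : ℝ) ≠ 0 := by positivity
      rw [integral_const_mul, integral_mul_const, integral_complex_ofReal, hc_int ξ hξ, hF_def]
      push_cast
      rw [inv_mul_cancel_left₀ (by exact_mod_cast hpos)]
    _ = ∫ t in Set.Ioi 0, ∫ ξ, planeWave ξ w * ((c ξ t : ℂ) * F ξ) :=
      (integral_integral_swap hint).symm
    _ = _ := by
      refine setIntegral_congr_fun measurableSet_Ioi fun t ht => ?_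
      rw [hfrac, integral_heatKernel_sub_mul_fourierInv hF ht, ← integral_const_mul]
      refine integral_congr_ae (ae_of_all _ fun ξ => ?_)
      simp only [hc_def]
      push_cast
      ring

/-- A Schwartz function is dominated by the Riesz potential of its fractional Laplacian. The
potential is an integral in `[0, ∞]`, so that no decay of the fractional Laplacian is needed. -/
lemma enorm_le_lintegral_rieszKernel_mul_fracLaplacian [Nontrivial E] {γ : ℝ} (hγ : 0 < γ)
    (g : 𝓢(E, ℂ)) (w : E) :
    ‖g w‖ₑ ≤ ∫⁻ y : E, rieszKernel γ (w - y) * ‖fracLaplacian (γ / 2) g y‖ₑ := by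
  have hΓ := Real.Gamma_pos_of_pos (half_pos hγ)
  have hmeas : Measurable fun y : E => ‖fracLaplacian (γ / 2) g y‖ₑ := by
    have h := integrable_norm_rpow_mul_fourier hγ.le g
    rw [fracLaplacian, mul_div_cancel₀ γ two_ne_zero]
    exact (continuous_fourierInv h).measurable.enorm
  calc
    _ ≤ ∫⁻ t in Set.Ioi 0, ENNReal.ofReal (t ^ (γ / 2 - 1) / Real.Gamma (γ / 2)) *
        ∫⁻ y : E, ENNReal.ofReal (heatKernel t (w - y)) * ‖fracLaplacian (γ / 2) g y‖ₑ := by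
      rw [eq_integral_heatKernel_fracLaplacian hγ g w]
      refine (enorm_integral_le_lintegral_enorm _).trans
        (setLIntegral_mono' measurableSet_Ioi fun t ht => ?_)
      have ht : 0 < t := ht
      rw [enorm_mul]
      refine mul_le_mul' (le_of_eq ?_) ((enorm_integral_le_lintegral_enorm _).trans_eq ?_)
      · rw [← ofReal_norm, Complex.norm_real, Real.norm_of_nonneg (by positivity)]
      · refine lintegral_congr fun y => ?_
        rw [enorm_mul, ← ofReal_norm, Complex.norm_real,
          Real.norm_of_nonneg (heatKernel_nonneg ht _)]
    _ = ∫⁻ t in Set.Ioi 0, ∫⁻ y : E, ENNReal.ofReal (t ^ (γ / 2 - 1) / Real.Gamma (γ / 2)) *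
        (ENNReal.ofReal (heatKernel t (w - y)) * ‖fracLaplacian (γ / 2) g y‖ₑ) := by
      refine lintegral_congr fun t => ?_
      rw [lintegral_const_mul _ (by fun_prop)]
    _ = ∫⁻ y : E, ∫⁻ t in Set.Ioi 0, ENNReal.ofReal (t ^ (γ / 2 - 1) / Real.Gamma (γ / 2)) *
        (ENNReal.ofReal (heatKernel t (w - y)) * ‖fracLaplacian (γ / 2) g y‖ₑ) := by
      refine lintegral_lintegral_swap (Measurable.aemeasurable ?_)
      have hsnd : Measurable fun q : ℝ × E => ‖fracLaplacian (γ / 2) g q.2‖ₑ :=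
        hmeas.comp measurable_snd
      fun_prop
    _ = _ := by
      refine lintegral_congr fun y => ?_
      rw [rieszKernel, ← lintegral_mul_const _ (by fun_prop)]
      simp_rw [mul_assoc]

end Representation

/-! ### Schur's test -/

/-- **Schur's test** with a single weight `h`, in lower-integral form. -/
theorem lintegral_lintegral_mul_rpow_le_of_schur {X : Type*} [MeasurableSpace X] {μ : Measure X}
    [SFinite μ] {p q : ℝ} (hpq : p.HolderConjugate q) {K : X → X → ℝ≥0∞}
    (hK : Measurable (Function.uncurry K)) {F h : X → ℝ≥0∞} (hF : Measurable F)
    (hh : Measurable h) (h_ne_zero : ∀ᵐ y ∂μ, h y ≠ 0) (h_ne_top : ∀ᵐ y ∂μ, h y ≠ ∞) {C : ℝ≥0∞}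
    (hrow : ∀ᵐ w ∂μ, ∫⁻ y, K w y * h y ^ q ∂μ ≤ C * h w ^ q)
    (hcol : ∀ᵐ y ∂μ, ∫⁻ w, K w y * h w ^ p ∂μ ≤ C * h y ^ p) :
    ∫⁻ w, (∫⁻ y, K w y * F y ∂μ) ^ p ∂μ ≤ C ^ p * ∫⁻ y, F y ^ p ∂μ := by
  have hp := hpq.pos
  have hq := hpq.symm.pos
  have hp0 := hpq.nonneg
  have hq0 := hpq.symm.nonneg
  have hKw : ∀ w, Measurable (K w) := fun w => hK.comp measurable_prodMk_left
  -- `hrow` contributes the power `p / q` of `C`, and `hcol` the first power.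
  have hpow : p / q + 1 = p := by
    have := hpq.inv_add_inv_eq_one
    field_simp at this ⊢
    linarith
  have hpointwise : ∀ᵐ w ∂μ, (∫⁻ y, K w y * F y ∂μ) ^ p ≤
      C ^ (p / q) * ∫⁻ y, h w ^ p * (K w y * (F y * (h y)⁻¹) ^ p) ∂μ := by
    filter_upwards [hrow] with w hw
    have hsplit : ∫⁻ y, K w y * F y ∂μ =
        ∫⁻ y, ((fun y => K w y ^ (1 / q) * h y) *
          fun y => K w y ^ (1 / p) * (F y * (h y)⁻¹)) y ∂μ := by
      refine lintegral_congr_ae ?_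
      filter_upwards [h_ne_zero, h_ne_top] with y h0 h1
      rw [Pi.mul_apply, mul_mul_mul_comm, ← ENNReal.rpow_add_of_nonneg _ _ (by positivity)
        (by positivity), one_div, one_div, hpq.symm.inv_add_inv_eq_one, ENNReal.rpow_one,
        mul_left_comm (h y), ENNReal.mul_inv_cancel h0 h1, mul_one]
    have hrootq : ∀ y, (K w y ^ (1 / q) * h y) ^ q = K w y * h y ^ q := fun y => by
      rw [ENNReal.mul_rpow_of_nonneg _ _ hq0, ← ENNReal.rpow_mul, one_div_mul_cancel hq.ne',
        ENNReal.rpow_one]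
    have hrootp : ∀ y, (K w y ^ (1 / p) * (F y * (h y)⁻¹)) ^ p =
        K w y * (F y * (h y)⁻¹) ^ p := fun y => by
      rw [ENNReal.mul_rpow_of_nonneg _ _ hp0, ← ENNReal.rpow_mul, one_div_mul_cancel hp.ne',
        ENNReal.rpow_one]
    have hholder := ENNReal.lintegral_mul_le_Lp_mul_Lq μ hpq.symm
      (f := fun y => K w y ^ (1 / q) * h y) (g := fun y => K w y ^ (1 / p) * (F y * (h y)⁻¹))
      (((hKw w).pow_const _).mul hh).aemeasurable
      (((hKw w).pow_const _).mul (hF.mul hh.inv)).aemeasurable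
    simp_rw [hrootq, hrootp] at hholder
    rw [← hsplit] at hholder
    calc
      _ ≤ ((∫⁻ y, K w y * h y ^ q ∂μ) ^ (1 / q) *
          (∫⁻ y, K w y * (F y * (h y)⁻¹) ^ p ∂μ) ^ (1 / p)) ^ p :=
        ENNReal.rpow_le_rpow hholder hp0
      _ = (∫⁻ y, K w y * h y ^ q ∂μ) ^ (p / q) * ∫⁻ y, K w y * (F y * (h y)⁻¹) ^ p ∂μ := by
        rw [ENNReal.mul_rpow_of_nonneg _ _ hp0, ← ENNReal.rpow_mul, ← ENNReal.rpow_mul,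
          one_div_mul_cancel hp.ne', ENNReal.rpow_one, one_div_mul_eq_div]
      _ ≤ (C * h w ^ q) ^ (p / q) * ∫⁻ y, K w y * (F y * (h y)⁻¹) ^ p ∂μ := by
        gcongr
      _ = _ := by
        rw [ENNReal.mul_rpow_of_nonneg _ _ (by positivity), ← ENNReal.rpow_mul,
          mul_div_cancel₀ p hq.ne', mul_assoc, lintegral_const_mul]
        exact (hKw w).mul ((hF.mul hh.inv).pow_const _)
  have hfst : Measurable fun z : X × X => h z.1 := hh.comp measurable_fst
  have hsnd : Measurable fun z : X × X => (F z.2 * (h z.2)⁻¹) ^ p :=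
    ((hF.mul hh.inv).pow_const p).comp measurable_snd
  have hjoint : Measurable (Function.uncurry fun w y => h w ^ p * (K w y * (F y * (h y)⁻¹) ^ p)) :=
    (hfst.pow_const p).mul (hK.mul hsnd)
  calc
    _ ≤ ∫⁻ w, C ^ (p / q) * ∫⁻ y, h w ^ p * (K w y * (F y * (h y)⁻¹) ^ p) ∂μ ∂μ :=
      lintegral_mono_ae hpointwise
    _ = C ^ (p / q) * ∫⁻ y, ∫⁻ w, h w ^ p * (K w y * (F y * (h y)⁻¹) ^ p) ∂μ ∂μ := by
      rw [lintegral_const_mul, lintegral_lintegral_swap hjoint.aemeasurable]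
      exact hjoint.lintegral_prod_right'
    _ ≤ C ^ (p / q) * ∫⁻ y, C * F y ^ p ∂μ := by
      refine mul_le_mul_right (lintegral_mono_ae ?_) _
      filter_upwards [hcol, h_ne_zero, h_ne_top] with y hy h0 h1
      calc
        _ = (∫⁻ w, K w y * h w ^ p ∂μ) * (F y * (h y)⁻¹) ^ p := by
          rw [← lintegral_mul_const]
          · refine lintegral_congr fun w => ?_
            ring
          · exact (hK.comp measurable_prodMk_right).mul (hh.pow_const p)
        _ ≤ C * h y ^ p * (F y * (h y)⁻¹) ^ p := by gcongr
        _ = _ := by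
          rw [mul_assoc, ← ENNReal.mul_rpow_of_nonneg _ _ hp0, mul_left_comm (h y),
            ENNReal.mul_inv_cancel h0 h1, mul_one]
    _ = _ := by
      rw [lintegral_const_mul _ (hF.pow_const p), ← mul_assoc]
      nth_rewrite 2 [← ENNReal.rpow_one C]
      rw [← ENNReal.rpow_add_of_nonneg _ _ (by positivity) zero_le_one, hpow]

/-! ### The weighted inequality -/

/-- The power weight `‖v‖^a` as a function on `ℝⁿ × ℝᵐ` with values in `[0, ∞]`. -/
noncomputable def vWeight {n m : ℕ} (a : ℝ) (w : ProductSpace n m) : ℝ≥0∞ :=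
  ENNReal.ofReal (‖vPart w‖ ^ a)

section VWeight

variable {n m : ℕ}

@[fun_prop]
lemma measurable_vWeight (a : ℝ) : Measurable (vWeight a : ProductSpace n m → ℝ≥0∞) := by
  unfold vWeight
  fun_prop

lemma vWeight_mul_vWeight {w : ProductSpace n m} (hw : vPart w ≠ 0) (a b : ℝ) :
    vWeight a w * vWeight b w = vWeight (a + b) w := by
  rw [vWeight, vWeight, vWeight, ← ENNReal.ofReal_mul (by positivity),
    ← Real.rpow_add (norm_pos_iff.2 hw)]

lemma vWeight_rpow (a : ℝ) {q : ℝ} (hq : 0 ≤ q) (w : ProductSpace n m) :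
    vWeight a w ^ q = vWeight (a * q) w := by
  rw [vWeight, vWeight, ENNReal.ofReal_rpow_of_nonneg (by positivity) hq,
    ← Real.rpow_mul (norm_nonneg _)]

lemma vWeight_ne_zero {w : ProductSpace n m} (hw : vPart w ≠ 0) (a : ℝ) : vWeight a w ≠ 0 :=
  (ENNReal.ofReal_pos.2 (Real.rpow_pos_of_pos (norm_pos_iff.2 hw) a)).ne'

lemma enorm_norm_vPart_rpow_mul (a : ℝ) (w : ProductSpace n m) (z : ℂ) :
    ‖((‖vPart w‖ ^ a : ℝ) : ℂ) * z‖ₑ = vWeight a w * ‖z‖ₑ := by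
  rw [enorm_mul, vWeight, ← ofReal_norm (((‖vPart w‖ ^ a : ℝ) : ℂ)), Complex.norm_real,
    Real.norm_of_nonneg (by positivity)]

/-- The weighted Riesz kernel `‖v‖^{-α} R(w - y) ‖v'‖^{-β}` maps the weight `‖v'‖^{-A}` to a
multiple of itself: it is the row condition and, with `(A, α)` and `(A', β)` exchanged, the column
condition of Schur's test. -/
lemma lintegral_vWeight_mul_rieszKernel_mul_vWeight {A A' α β : ℝ} (hA : A + A' = m)
    (hαβ : 0 < α + β) (hα : α < A) (hβ : β < A') (w : ProductSpace n m) (hw : vPart w ≠ 0) :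
    ∫⁻ y : ProductSpace n m, vWeight (-α) w * rieszKernel (α + β) (w - y) * vWeight (-β) y *
        vWeight (-A) y =
      ENNReal.ofReal (rieszConst m (A' + α) / rieszConst m (A' - β)) * vWeight (-A) w := by
  have hm : (0 : ℝ) < m := by linarith
  have hconst : 0 ≤ rieszConst m (A' + α) / rieszConst m (A' - β) :=
    (div_pos (rieszConst_pos (by linarith) (by linarith))
      (rieszConst_pos (by linarith) (by linarith))).le
  calc
    _ = ∫⁻ y : ProductSpace n m, vWeight (-α) w *
        (rieszKernel (α + β) (w - y) * ENNReal.ofReal (‖vPart y‖ ^ (-β + -A))) := by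
      refine lintegral_congr_ae ?_
      filter_upwards [ae_vPart_ne_zero (by exact_mod_cast hm)] with y hy
      rw [mul_assoc, vWeight_mul_vWeight hy, mul_assoc, vWeight]
      rfl
    _ = _ := by
      rw [lintegral_const_mul _ (by fun_prop),
        lintegral_rieszKernel_sub_mul_norm_vPart_rpow hαβ (by linarith) (by linarith) w hw,
        show α + β + (m + (-β + -A)) = A' + α by linarith,
        show (m : ℝ) + (-β + -A) = A' - β by linarith, ENNReal.ofReal_mul hconst, mul_left_comm]
      congr 1
      change vWeight (-α) w * vWeight (α + β + (-β + -A)) w = _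
      rw [vWeight_mul_vWeight hw]
      congr 1
      ring

end VWeight

lemma rieszKernel_sub_comm {E : Type*} [NormedAddCommGroup E] [InnerProductSpace ℝ E] (s : ℝ)
    (w y : E) : rieszKernel s (w - y) = rieszKernel s (y - w) := by
  simp only [rieszKernel, heatKernel_sub_comm _ w y]

lemma rieszConst_div_rieszConst {d A A' α β : ℝ} (hA : A + A' = d) (hαβ : 0 < α + β) (hα : α < A)
    (hβ : β < A') :
    rieszConst d (A' + α) / rieszConst d (A' - β) = 2 ^ (-(α + β)) *
      ((Real.Gamma ((A - α) / 2) * Real.Gamma ((A' - β) / 2)) /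
        (Real.Gamma ((A' + α) / 2) * Real.Gamma ((A + β) / 2))) := by
  have h1 := Real.Gamma_pos_of_pos (show 0 < (A - α) / 2 by linarith)
  have h2 := Real.Gamma_pos_of_pos (show 0 < (A' - β) / 2 by linarith)
  have h3 := Real.Gamma_pos_of_pos (show 0 < (A' + α) / 2 by linarith)
  have h4 := Real.Gamma_pos_of_pos (show 0 < (A + β) / 2 by linarith)
  have hpow : (2 : ℝ) ^ (-(α + β)) * 2 ^ (A' + α) = 2 ^ (A' - β) := by
    rw [← Real.rpow_add two_pos]
    ring_nf
  rw [rieszConst, rieszConst, show (d - (A' + α)) / 2 = (A - α) / 2 by linarith,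
    show (d - (A' - β)) / 2 = (A + β) / 2 by linarith, ← hpow]
  field_simp

theorem corollary1 (n m : ℕ) (p p' α β : ℝ) (hp : 1 < p) (hpp' : 1 / p + 1 / p' = 1)
    (hαβ₀ : 0 < α + β) (hαβ : α + β < m) (hα : α < m / p) (hβ : β < m / p')
    (g : 𝓢(ProductSpace n m, ℂ)) :
    eLpNorm (fun w : ProductSpace n m => ((‖vPart w‖ ^ (-α) : ℝ) : ℂ) * g w)
        (ENNReal.ofReal p) volume ≤
      ENNReal.ofReal ((2 : ℝ) ^ (-(α + β)) *
        ((Real.Gamma (m / (2 * p) - α / 2) * Real.Gamma (m / (2 * p') - β / 2)) /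
          (Real.Gamma (m / (2 * p') + α / 2) * Real.Gamma (m / (2 * p) + β / 2)))) *
      eLpNorm (fun w : ProductSpace n m =>
          ((‖vPart w‖ ^ β : ℝ) : ℂ) * fracLaplacian ((α + β) / 2) g w)
        (ENNReal.ofReal p) volume := by
  have hpq : p.HolderConjugate p' := by
    rw [Real.holderConjugate_iff]
    exact ⟨hp, by simpa only [one_div] using hpp'⟩
  have hp_pos := hpq.pos
  have hq_pos := hpq.symm.pos
  have hm : 0 < m := by exact_mod_cast hαβ₀.trans hαβ
  have hA : (m : ℝ) / p + m / p' = m := by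
    rw [div_eq_mul_one_div, div_eq_mul_one_div (m : ℝ) p', ← mul_add, hpp', mul_one]
  have : Nontrivial (ProductSpace n m) := by
    have : Nonempty (Fin n ⊕ Fin m) := ⟨Sum.inr ⟨0, hm⟩⟩
    infer_instance
  have hvPart := ae_vPart_ne_zero (n := n) hm
  set C : ℝ≥0∞ := ENNReal.ofReal ((2 : ℝ) ^ (-(α + β)) *
    ((Real.Gamma (m / (2 * p) - α / 2) * Real.Gamma (m / (2 * p') - β / 2)) /
      (Real.Gamma (m / (2 * p') + α / 2) * Real.Gamma (m / (2 * p) + β / 2)))) with hC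
  have hhalf : ∀ a b : ℝ, (m / a + b) / 2 = m / (2 * a) + b / 2 := fun a b => by
    rw [add_div, div_div, mul_comm a]
  have hhalf' : ∀ a b : ℝ, (m / a - b) / 2 = m / (2 * a) - b / 2 := fun a b => by
    rw [sub_div, div_div, mul_comm a]
  have hC_row : ENNReal.ofReal (rieszConst m (m / p' + α) / rieszConst m (m / p' - β)) = C := by
    rw [rieszConst_div_rieszConst hA hαβ₀ hα hβ, hC]
    simp only [hhalf, hhalf']
  have hC_col : ENNReal.ofReal (rieszConst m (m / p + β) / rieszConst m (m / p - α)) = C := by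
    rw [rieszConst_div_rieszConst ((add_comm _ _).trans hA) (by linarith) hβ hα, hC]
    simp only [hhalf, hhalf']
    rw [add_comm β α, mul_comm (Real.Gamma (m / (2 * p') - β / 2)),
      mul_comm (Real.Gamma (m / (2 * p) + β / 2))]
  set f : ProductSpace n m → ℂ := fracLaplacian ((α + β) / 2) g with hf
  have hfm : Measurable f := by
    have h := integrable_norm_rpow_mul_fourier hαβ₀.le g
    rw [hf, fracLaplacian, mul_div_cancel₀ (α + β) two_ne_zero]
    exact (continuous_fourierInv h).measurable
  set K : ProductSpace n m → ProductSpace n m → ℝ≥0∞ := fun w y =>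
    vWeight (-α) w * rieszKernel (α + β) (w - y) * vWeight (-β) y with hK
  have hKm : Measurable (Function.uncurry K) := by
    have h1 : Measurable fun z : ProductSpace n m × ProductSpace n m => vWeight (-α) z.1 :=
      (measurable_vWeight _).comp measurable_fst
    have h2 : Measurable fun z : ProductSpace n m × ProductSpace n m => vWeight (-β) z.2 :=
      (measurable_vWeight _).comp measurable_snd
    simp only [hK, Function.uncurry_def]
    fun_prop
  -- The exponent is the one for which the `p'`-th and `p`-th powers of the Schur weight
  -- are `‖v‖^{-m/p}` and `‖v‖^{-m/p'}`.
  set h : ProductSpace n m → ℝ≥0∞ := vWeight (-(m / (p * p'))) with hh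
  have hhq : ∀ w, h w ^ p' = vWeight (-(m / p)) w := fun w => by
    rw [hh, vWeight_rpow _ hq_pos.le]
    congr 1
    field_simp
  have hhp : ∀ w, h w ^ p = vWeight (-(m / p')) w := fun w => by
    rw [hh, vWeight_rpow _ hp_pos.le]
    congr 1
    field_simp
  have hschur := lintegral_lintegral_mul_rpow_le_of_schur hpq hKm
    (F := fun y => vWeight β y * ‖f y‖ₑ) (h := h) (C := C)
    ((measurable_vWeight β).mul hfm.enorm) (measurable_vWeight _)
    (hvPart.mono fun w hw => vWeight_ne_zero hw _) (ae_of_all _ fun w => ENNReal.ofReal_ne_top)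
    (by
      filter_upwards [hvPart] with w hw
      simp_rw [hhq]
      rw [← hC_row]
      exact (lintegral_vWeight_mul_rieszKernel_mul_vWeight hA hαβ₀ hα hβ w hw).le)
    (by
      filter_upwards [hvPart] with y hy
      simp_rw [hhp]
      rw [← hC_col, ← lintegral_vWeight_mul_rieszKernel_mul_vWeight ((add_comm _ _).trans hA)
        (by linarith) hβ hα y hy]
      refine (lintegral_congr fun w => ?_).le
      rw [hK, rieszKernel_sub_comm, add_comm α β]
      ring)
  have hdom : ∀ w, ‖((‖vPart w‖ ^ (-α) : ℝ) : ℂ) * g w‖ₑ ≤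
      ∫⁻ y, K w y * (vWeight β y * ‖f y‖ₑ) := by
    intro w
    calc
      _ ≤ vWeight (-α) w * ∫⁻ y, rieszKernel (α + β) (w - y) * ‖f y‖ₑ := by
        rw [enorm_norm_vPart_rpow_mul]
        gcongr
        exact enorm_le_lintegral_rieszKernel_mul_fracLaplacian hαβ₀ g w
      _ = _ := by
        rw [← lintegral_const_mul _ (by fun_prop)]
        refine lintegral_congr_ae ?_
        filter_upwards [hvPart] with y hy
        have hone : vWeight (-β) y * vWeight β y = 1 := by
          rw [vWeight_mul_vWeight hy, neg_add_cancel, vWeight, Real.rpow_zero, ENNReal.ofReal_one]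
        calc
          _ = vWeight (-α) w * (rieszKernel (α + β) (w - y) * ‖f y‖ₑ) *
              (vWeight (-β) y * vWeight β y) := by rw [hone, mul_one]
          _ = _ := by
            rw [hK]
            ring
  rw [eLpNorm_eq_lintegral_rpow_enorm_toReal (by simpa using hp_pos) ENNReal.ofReal_ne_top,
    eLpNorm_eq_lintegral_rpow_enorm_toReal (by simpa using hp_pos) ENNReal.ofReal_ne_top,
    ENNReal.toReal_ofReal hp_pos.le]
  calc
    _ ≤ (C ^ p * ∫⁻ y, (vWeight β y * ‖f y‖ₑ) ^ p) ^ (1 / p) := by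
      refine ENNReal.rpow_le_rpow (le_trans (lintegral_mono fun w => ?_) hschur) (by positivity)
      exact ENNReal.rpow_le_rpow (hdom w) hp_pos.le
    _ = _ := by
      rw [ENNReal.mul_rpow_of_nonneg _ _ (by positivity), ← ENNReal.rpow_mul,
        mul_one_div_cancel hp_pos.ne', ENNReal.rpow_one]
      simp_rw [enorm_norm_vPart_rpow_mul]
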